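/- Call a set $\mathfrak{d}$ of positive integers uniformly log-discrete if there is $\delta>0$ with $|\log d-\log d'|>\delta$ for all distinct $d,d'\in\mathfrak{d}$. Let $h=\log H$, where $H$ is the absolute multiplicative Weil height on $\mathbb{P}^1(\overline{\mathbb{Q}})$, and let $\eta\in\mathrm{Pic}(\mathbb{P}^1)\otimes\mathbb{R}$ be the class of $\mathcal{O}(1)$. Call a set $S$ of endomorphisms of $\mathbb{P}^1$ over $\overline{\mathbb{Q}}$ height controlled and uniformly log-discrete if there are real numbers $d_\phi>1$ $(\phi\in S)$ with $\phi^*\eta=d_\phi\eta$ for all $\phi\in S$ such that $$\sup_{\phi\in S}\ \sup_{P\in\mathbb{P}^1(\overline{\mathbb{Q}})}\big|h(\phi(P))-d_\phi h(P)\big|<\infty ,$$ and there is $\delta>0$ with $|\log d_\phi-\log d_\psi|>\delta$ for all distinct $\phi,\psi\in S$. Let $M_S$ denote the monoid generated by $S$ and the identity under composition. Let $\mathfrak{d}$ be a uniformly log-discrete set of positive integers, let $c\in\overline{\mathbb{Q}}$ with $c\neq 0$, and let $$S=S_{\mathfrak{d},c}=\{z^d+c\,:\,d\in\mathfrak{d},\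 d\geq2\}.$$ Then: 1. $S$ is height controlled and uniformly log-discrete. 2. $M_S$ is free on $S$: distinct finite words in $S$ give distinct compositions. 3. If $S$ has at least two elements (so that $M_S$ is a non-abelian free monoid), then there is a constant $B_S$, depending only on $S$, such that for every $\epsilon>0$ there is $b=b(S,\epsilon)>0$ with the following property: for every $P\in\mathbb{P}^1(\overline{\mathbb{Q}})$ with $H(P)>B_S$ there are constants $c_1,c_2>0$ (depending on $P$, $S$ and $\epsilon$) such that for all sufficiently large $B$ the set $\{f\in M_S: H(f(P))\leq B\}$ is finite and $$c_1(\log B)^{b}\ \leq\ \#\{f\in M_S\,:\,H(f(P))\leq B\}\ \leq\ c_2(\log B)^{b+\epsilon}.$$ -/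

import Mathlib

open scoped LinearAlgebra.Projectivization

noncomputable section

namespace OrbitCount

/-! ### The projective line and its endomorphisms -/

/-- The closed points of the projective line over `k`. -/
abbrev P1 (k : Type*) [Field k] : Type _ := ℙ k (Fin 2 → k)

/-- The point `[t : 1]`. -/
def affinePt {k : Type*} [Field k] (t : k) : P1 k :=
  Projectivization.mk k ![t, 1] (by simp)

/-- The point at infinity `[1 : 0]`. -/
def inftyPt (k : Type*) [Field k] : P1 k :=
  Projectivization.mk k ![1, 0] (by simp)

/-- A pair of binary forms of the same degree without a common zero. Over an algebraically
closed field these are exactly the data that give endomorphisms of the projective line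
(two pairs give the same endomorphism if and only if they are proportional). -/
structure FormPair (k : Type*) [Field k] where
  deg : ℕ
  form : Fin 2 → MvPolynomial (Fin 2) k
  homogeneous : ∀ i, (form i).IsHomogeneous deg
  no_common_zero : ∀ v : Fin 2 → k, (∀ i, MvPolynomial.eval v (form i) = 0) → v = 0

theorem FormPair.eval_ne_zero {k : Type*} [Field k] (p : FormPair k) {v : Fin 2 → k}
    (hv : v ≠ 0) : (fun i => MvPolynomial.eval v (p.form i)) ≠ 0 :=
  fun h => hv (p.no_common_zero v (congrFun h))

theorem eval_smul_of_isHomogeneous {k : Type*} [Field k] {n : ℕ} {F : MvPolynomial (Fin 2) k}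
    (hF : F.IsHomogeneous n) (t : k) (v : Fin 2 → k) :
    MvPolynomial.eval (t • v) F = t ^ n * MvPolynomial.eval v F := by
  rw [MvPolynomial.eval_eq, MvPolynomial.eval_eq, Finset.mul_sum]
  refine Finset.sum_congr rfl fun m hm => ?_
  have h : n = ∑ i ∈ m.support, m i := hF.degree_eq_sum_deg_support hm
  simp only [Pi.smul_apply, smul_eq_mul, mul_pow, Finset.prod_mul_distrib]
  rw [Finset.prod_pow_eq_pow_sum, ← h]
  ring

/-- The endomorphism `[x : y] ↦ [F₀(x, y) : F₁(x, y)]` of the projective line, as a map on closed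
points. `Function.End` is the monoid of self-maps under composition. -/
def FormPair.toEnd {k : Type*} [Field k] (p : FormPair k) : Function.End (P1 k) :=
  fun P => Projectivization.lift
    (fun v : {v : Fin 2 → k // v ≠ 0} =>
      Projectivization.mk k (fun i => MvPolynomial.eval v.1 (p.form i)) (p.eval_ne_zero v.2))
    (by
      rintro ⟨v, hv⟩ ⟨w, hw⟩ t h
      change v = t • w at h
      subst h
      rw [Projectivization.mk_eq_mk_iff']
      exact ⟨t ^ p.deg, funext fun i => (eval_smul_of_isHomogeneous (p.homogeneous i) t w).symm⟩) P

/-- The forms `(X ^ d + c Y ^ d, Y ^ d)`. -/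
def unicriticalForms {k : Type*} [Field k] (d : ℕ) (c : k) : FormPair k where
  deg := d
  form := ![MvPolynomial.X 0 ^ d + MvPolynomial.C c * MvPolynomial.X 1 ^ d, MvPolynomial.X 1 ^ d]
  homogeneous := by
    intro i
    fin_cases i
    · exact (MvPolynomial.isHomogeneous_X_pow 0 d).add
        (MvPolynomial.isHomogeneous_C_mul_X_pow c 1 d)
    · exact MvPolynomial.isHomogeneous_X_pow 1 d
  no_common_zero := by
    intro v h
    have h1 : v 1 ^ d = 0 := by simpa using h 1
    have h0 : v 0 ^ d = 0 := by simpa [h1] using h 0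
    funext i
    fin_cases i
    · exact eq_zero_of_pow_eq_zero h0
    · exact eq_zero_of_pow_eq_zero h1

/-- The polynomial map `z ↦ z ^ d + c`, extended to the projective line. -/
def unicritical {k : Type*} [Field k] (d : ℕ) (c : k) : Function.End (P1 k) :=
  (unicriticalForms d c).toEnd

/-! ### Divisor classes on the projective line and their pullbacks -/

/-- Divisors on the projective line with real coefficients. -/
abbrev Div (k : Type*) [Field k] : Type _ := P1 k →₀ ℝ

/-- The divisor of zeros of a one-variable polynomial on the affine line. -/
def zerosDiv {k : Type*} [Field k] (g : Polynomial k) : Div k :=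
  (g.roots.map fun t => Finsupp.single (affinePt t) (1 : ℝ)).sum

/-- The divisor of zeros and poles of a rational function (over an algebraically closed field);
its order at infinity is minus its degree. -/
def ratFuncDiv {k : Type*} [Field k] (f : RatFunc k) : Div k :=
  zerosDiv f.num - zerosDiv f.denom - Finsupp.single (inftyPt k) (f.intDegree : ℝ)

/-- The real span of the principal divisors. -/
def principal (k : Type*) [Field k] : Submodule ℝ (Div k) :=
  Submodule.span ℝ {D | ∃ f : RatFunc k, f ≠ 0 ∧ D = ratFuncDiv f}

/-- The group `Pic(ℙ¹) ⊗ ℝ` (for `k` algebraically closed): real divisors modulo the real span of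
the principal divisors. -/
abbrev PicR (k : Type*) [Field k] : Type _ := Div k ⧸ principal k

/-- The class of a divisor. -/
def divClass {k : Type*} [Field k] (D : Div k) : PicR k := (principal k).mkQ D

/-- The divisor of zeros of a binary form `L` of degree `n`: the zeros `[t : 1]` are the roots
of `L(z, 1)`, and the multiplicity of `[1 : 0]` is the drop in degree of `L(z, 1)`. -/
def formDiv {k : Type*} [Field k] (n : ℕ) (L : MvPolynomial (Fin 2) k) : Div k :=
  zerosDiv (MvPolynomial.aeval ![(Polynomial.X : Polynomial k), 1] L) +
    Finsupp.single (inftyPt k)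
      ((n : ℝ) - (MvPolynomial.aeval ![(Polynomial.X : Polynomial k), 1] L).natDegree)

/-- The pullback of the point `Q = [a : b]`: the zeros of `b F₀ - a F₁`, that is, the fibre over
`Q` counted with ramification indices. -/
def FormPair.fiber {k : Type*} [Field k] (p : FormPair k) (Q : P1 k) : Div k :=
  formDiv p.deg
    (MvPolynomial.C (Q.rep 1) * p.form 0 - MvPolynomial.C (Q.rep 0) * p.form 1)

/-- The pullback of divisors. -/
def FormPair.pullback {k : Type*} [Field k] (p : FormPair k) (D : Div k) : Div k :=
  D.sum fun Q a => a • p.fiber Q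

/-- `φ` is an endomorphism of the projective line with `φ^* η = η'`. The class of the pullback of
a divisor depends only on its class, so any representative of `η` can be used. -/
def IsPullback {k : Type*} [Field k] (φ : Function.End (P1 k)) (η η' : PicR k) : Prop :=
  ∃ p : FormPair k, p.toEnd = φ ∧ ∃ D : Div k, divClass D = η ∧ divClass (p.pullback D) = η'

/-- The class of a point, i.e. of `𝒪(1)`. -/
def hyperplaneClass (k : Type*) [Field k] : PicR k :=
  divClass (Finsupp.single (inftyPt k) 1)

/-! ### Heights -/

/-- The field of algebraic numbers. -/
abbrev Qbar : Type := AlgebraicClosure ℚ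

open Classical in
/-- The absolute multiplicative Weil height on the algebraic points of the projective line,
a height associated to `𝒪(1)`: `H([t : 1])` is the absolute height of `t`, and `H([1 : 0]) = 1`. -/
def mulHeight (P : P1 Qbar) : ℝ :=
  if P.rep 1 = 0 then 1 else NumberField.absMulHeight₁ (P.rep 0 / P.rep 1)

/-- The absolute logarithmic Weil height. -/
def logHeight (P : P1 Qbar) : ℝ := Real.log (mulHeight P)

/-! ### Height controlled and uniformly log-discrete sets -/

/-- `S` is height controlled with respect to `𝒪(1)`, with eigenvalues `d φ`: each `φ ∈ S` is an
endomorphism with `φ^* η = d φ • η` and `d φ > 1`, and the differences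
`|h(φ(P)) - d φ * h(P)|` are bounded uniformly in `P` and in `φ ∈ S`. -/
def HeightControlledWith (S : Set (Function.End (P1 Qbar)))
    (d : Function.End (P1 Qbar) → ℝ) : Prop :=
  (∀ φ ∈ S, 1 < d φ ∧ IsPullback φ (hyperplaneClass Qbar) (d φ • hyperplaneClass Qbar)) ∧
    ∃ C : ℝ, ∀ φ ∈ S, ∀ P : P1 Qbar, |logHeight (φ P) - d φ * logHeight P| ≤ C

/-- `S` is height controlled and uniformly log-discrete with respect to `𝒪(1)`. -/
def HeightControlledLogDiscrete (S : Set (Function.End (P1 Qbar))) : Prop :=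
  ∃ d : Function.End (P1 Qbar) → ℝ, HeightControlledWith S d ∧
    ∃ δ : ℝ, 0 < δ ∧ ∀ φ ∈ S, ∀ ψ ∈ S, φ ≠ ψ → δ < |Real.log (d φ) - Real.log (d ψ)|

/-- A set of positive integers is uniformly log-discrete. -/
def UniformlyLogDiscrete (𝔡 : Set ℕ) : Prop :=
  ∃ δ : ℝ, 0 < δ ∧ ∀ d ∈ 𝔡, ∀ d' ∈ 𝔡, d ≠ d' → δ < |Real.log (d : ℝ) - Real.log (d' : ℝ)|

/-! ### Generated monoids and the function count -/

/-- The monoid `M_S` generated by `S` (and the identity) under composition. -/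
def genMonoid (S : Set (Function.End (P1 Qbar))) : Submonoid (Function.End (P1 Qbar)) :=
  Submonoid.closure S

/-- The monoid generated by `S` is free on `S`: distinct finite words in `S` give distinct
compositions. -/
def GeneratesFreely (S : Set (Function.End (P1 Qbar))) : Prop :=
  Function.Injective (FreeMonoid.lift fun φ : S => (φ : Function.End (P1 Qbar)))

/-- The two-sided bound `(log B)^b ≪ #{f ∈ M_S : H(f(P)) ≤ B} ≪ (log B)^(b + ε)` as `B → ∞`, for
all `P` of large height. The height threshold depends only on `S`, the exponent only on
`S` and `ε`, and the implied constants on `S`, `ε` and `P`. -/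
def FunctionCount (S : Set (Function.End (P1 Qbar))) : Prop :=
  ∃ B₀ : ℝ, ∀ ε : ℝ, 0 < ε → ∃ b : ℝ, 0 < b ∧
    ∀ P : P1 Qbar, B₀ < mulHeight P →
      ∃ c₁ c₂ : ℝ, 0 < c₁ ∧ 0 < c₂ ∧ ∀ᶠ B : ℝ in Filter.atTop,
        {f | f ∈ genMonoid S ∧ mulHeight (f P) ≤ B}.Finite ∧
        c₁ * Real.log B ^ b ≤ ({f | f ∈ genMonoid S ∧ mulHeight (f P) ≤ B}.ncard : ℝ) ∧
        ({f | f ∈ genMonoid S ∧ mulHeight (f P) ≤ B}.ncard : ℝ) ≤ c₂ * Real.log B ^ (b + ε)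

/-- The set `{z ^ d + c : d ∈ 𝔡, d ≥ 2}`. -/
def unicriticalSet (𝔡 : Set ℕ) (c : Qbar) : Set (Function.End (P1 Qbar)) :=
  {φ | ∃ d ∈ 𝔡, 2 ≤ d ∧ φ = unicritical d c}

end OrbitCount

end

/-!
Both the degree and the logarithmic height are multiplied by `d` under `z ^ d + c`, the latter up to
the error `log 2 + h(c)`, which does not depend on `d`.

*Freeness.* Stripping common outermost letters from a relation between two words leaves an identity
`P ^ a = Q ^ b` between polynomials given by words, and `a < b` would make every root of `P`
multiple, in the strong sense that `P` has at most `deg P / 2` distinct roots. But `u ^ e + c` with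
`c ≠ 0` has multiple roots only at the zeros of `u'`, so more than half of its roots are distinct.

*Counting.* A composition `f` of degree `m` satisfies `|h(f(P)) - m h(P)| ≤ A (m - 1)`, so for
`h(P) > A` the condition `H(f(P)) ≤ B` amounts to `log m ≤ log log B + O(1)`. Since `M_S` is free,
this counts words whose letters have weights `log d`. Their number `N(t)` satisfies
`N(t) = 1 + ∑ N(t - log d)`, the sum running over the letters with `log d ≤ t`, and comparing this
with the solution `exp (b t)` of the homogeneous equation, where `∑ d ^ (-b) = 1`, shows that `N(t)`
has order of magnitude `exp (b t)`. Log-discreteness makes the series `∑ d ^ (-s)` converge for all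
`s > 0`, so that `b` exists, and bounds its tails.
-/

namespace OrbitCount

/-! ### Heights in extensions of number fields -/

section Extension

open NumberField Height Module

variable {K L : Type*} [Field K] [NumberField K] [Field L] [NumberField L]

theorem prod_infinitePlace_pow_mult_eq_prod_embeddings {M : Type*} [CommMonoid M]
    (f : InfinitePlace K → M) :
    ∏ v : InfinitePlace K, f v ^ v.mult = ∏ φ : K →+* ℂ, f (InfinitePlace.mk φ) := by
  classical
  rw [← Finset.prod_fiberwise' Finset.univ InfinitePlace.mk f]
  exact Finset.prod_congr rfl fun v _ => by
    rw [Finset.prod_const, InfinitePlace.card_filter_mk_eq]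

theorem card_embeddings_lying_over [Algebra K L] (φ : K →+* ℂ) :
    Nat.card {ψ : L →+* ℂ // ψ.comp (algebraMap K L) = φ} = finrank K L := by
  let _ : Algebra K ℂ := φ.toAlgebra
  rw [← AlgHom.card K L ℂ, ← Nat.card_eq_fintype_card]
  exact Nat.card_congr
    { toFun := fun ψ => { ψ.1 with commutes' := fun r => RingHom.congr_fun ψ.2 r }
      invFun := fun σ => ⟨σ.toRingHom, RingHom.ext fun r => σ.commutes r⟩
      left_inv := fun _ => rfl
      right_inv := fun _ => rfl }

theorem prod_embeddings_comp_algebraMap [Algebra K L] {M : Type*} [CommMonoid M]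
    (f : (K →+* ℂ) → M) :
    ∏ ψ : L →+* ℂ, f (ψ.comp (algebraMap K L)) = (∏ φ : K →+* ℂ, f φ) ^ finrank K L := by
  classical
  rw [← Finset.prod_fiberwise' Finset.univ (fun ψ : L →+* ℂ => ψ.comp (algebraMap K L)) f,
    ← Finset.prod_pow]
  exact Finset.prod_congr rfl fun φ _ => by
    rw [Finset.prod_const, ← card_embeddings_lying_over (L := L) φ, Nat.card_eq_fintype_card,
      Fintype.card_subtype]

theorem absNorm_mul_mulHeight_integers {ι : Type*} [Finite ι] {x : ι → 𝓞 K} (hx : x ≠ 0) :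
    (Ideal.span (Set.range x)).absNorm * Height.mulHeight (fun i => (x i : K)) =
      ∏ φ : K →+* ℂ, ⨆ i, ‖φ (x i)‖ := by
  have hx' : (fun i => (x i : K)) ≠ 0 := fun h =>
    hx (funext fun i => RingOfIntegers.ext (by simpa using congrFun h i))
  rw [NumberField.mulHeight_eq hx', mul_left_comm, absNorm_mul_finprod_finitePlace_eq_one hx,
    mul_one, prod_infinitePlace_pow_mult_eq_prod_embeddings (fun v => ⨆ i, v (x i : K))]
  rfl

theorem absNorm_span_algebraMap [Algebra K L] {ι : Type*} (x : ι → 𝓞 K) :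
    (Ideal.span (Set.range fun i => algebraMap (𝓞 K) (𝓞 L) (x i))).absNorm =
      (Ideal.span (Set.range x)).absNorm ^ finrank K L := by
  have hspan : Ideal.span (Set.range fun i => algebraMap (𝓞 K) (𝓞 L) (x i)) =
      (Ideal.span (Set.range x)).map (algebraMap (𝓞 K) (𝓞 L)) := by
    rw [Ideal.map_span, ← Set.range_comp]
    rfl
  rw [hspan, Ideal.absNorm_algebraMap, IsFractionRing.finrank_eq (𝓞 K) K (𝓞 L) L]

theorem mulHeight_algebraMap_integers [Algebra K L] {ι : Type*} [Finite ι] {x : ι → 𝓞 K}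
    (hx : x ≠ 0) :
    Height.mulHeight (fun i => algebraMap K L (x i)) =
      Height.mulHeight (fun i => (x i : K)) ^ finrank K L := by
  have hinj : Function.Injective (algebraMap (𝓞 K) (𝓞 L)) :=
    FaithfulSMul.algebraMap_injective _ _
  have hy : (fun i => algebraMap (𝓞 K) (𝓞 L) (x i)) ≠ 0 := fun h =>
    hx (funext fun i => hinj (by simpa using congrFun h i))
  have hnorm_ne : ((Ideal.span (Set.range x)).absNorm : ℝ) ≠ 0 := by
    rw [Nat.cast_ne_zero, Ne, Ideal.absNorm_eq_zero_iff, Ideal.span_eq_bot]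
    exact fun h => hx (funext fun i => h _ ⟨i, rfl⟩)
  have heightL := absNorm_mul_mulHeight_integers hy
  have hprod := prod_embeddings_comp_algebraMap (L := L) fun φ : K →+* ℂ => ⨆ i, ‖φ (x i)‖
  rw [← absNorm_mul_mulHeight_integers hx, mul_pow] at hprod
  rw [absNorm_span_algebraMap, Nat.cast_pow] at heightL
  exact mul_left_cancel₀ (pow_ne_zero _ hnorm_ne) (heightL.trans hprod)

theorem mulHeight₁_algebraMap [Algebra K L] (x : K) :
    mulHeight₁ (algebraMap K L x) = mulHeight₁ x ^ finrank K L := by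
  obtain ⟨a, b, hb, rfl⟩ := IsFractionRing.div_surjective (A := 𝓞 K) x
  have hb₀ : b ≠ 0 := nonZeroDivisors.ne_zero hb
  have h := mulHeight_algebraMap_integers (L := L) (x := ![a, b])
    (fun h => hb₀ (by simpa using congrFun h 1))
  have hL : (fun i => algebraMap K L (![a, b] i)) =
      ![algebraMap K L (algebraMap (𝓞 K) K a), algebraMap K L (algebraMap (𝓞 K) K b)] := by
    ext i; fin_cases i <;> rfl
  have hK : (fun i => (![a, b] i : K)) = ![algebraMap (𝓞 K) K a, algebraMap (𝓞 K) K b] := by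
    ext i; fin_cases i <;> rfl
  rwa [hL, hK, ← mulHeight₁_div_eq_mulHeight, ← mulHeight₁_div_eq_mulHeight, ← map_div₀] at h

end Extension

/-! ### Absolute heights -/

section Absolute

open NumberField Height Module IntermediateField

variable {E : Type*} [Field E] [CharZero E]

theorem absMulHeight₁_coe (F : IntermediateField ℚ E) [NumberField F] (x : F) :
    absMulHeight₁ (x : E) = mulHeight₁ x ^ ((finrank ℚ F : ℝ)⁻¹) := by
  have hx : IsIntegral ℚ (x : E) :=
    (Algebra.IsIntegral.isIntegral (R := ℚ) x).map F.val
  have : FiniteDimensional ℚ ℚ⟮(x : E)⟯ := adjoin.finiteDimensional hx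
  have : NumberField ℚ⟮(x : E)⟯ := {}
  let _ : Algebra ℚ⟮(x : E)⟯ F :=
    (inclusion (show ℚ⟮(x : E)⟯ ≤ F by simp)).toRingHom.toAlgebra
  have hgen : mulHeight₁ x =
      mulHeight₁ (AdjoinSimple.gen ℚ (x : E)) ^ finrank ℚ⟮(x : E)⟯ F :=
    mulHeight₁_algebraMap (AdjoinSimple.gen ℚ (x : E))
  have hdeg : (finrank ℚ⟮(x : E)⟯ F : ℝ) ≠ 0 := Nat.cast_ne_zero.mpr finrank_pos.ne'
  rw [absMulHeight₁, dif_pos hx, hgen, ← finrank_mul_finrank ℚ ℚ⟮(x : E)⟯ F, ← Real.rpow_natCast,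
    ← Real.rpow_mul (by positivity), Nat.cast_mul, mul_inv, mul_left_comm, mul_inv_cancel₀ hdeg,
    mul_one]

theorem absLogHeight₁_coe (F : IntermediateField ℚ E) [NumberField F] (x : F) :
    absLogHeight₁ (x : E) = logHeight₁ x / finrank ℚ F := by
  rw [absLogHeight₁, absMulHeight₁_coe, Real.log_rpow (mulHeight₁_pos x), div_eq_inv_mul]
  rfl

variable [Algebra.IsAlgebraic ℚ E]

theorem exists_numberField_mem_mem (x y : E) :
    ∃ F : IntermediateField ℚ E, NumberField F ∧ x ∈ F ∧ y ∈ F := by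
  have hfin : FiniteDimensional ℚ (adjoin ℚ {x, y}) :=
    finiteDimensional_adjoin fun z _ => Algebra.IsIntegral.isIntegral z
  exact ⟨adjoin ℚ {x, y}, {}, subset_adjoin _ _ (by simp), subset_adjoin _ _ (by simp)⟩

theorem one_le_absMulHeight₁ (x : E) : 1 ≤ absMulHeight₁ x := by
  obtain ⟨F, hF, hx, -⟩ := exists_numberField_mem_mem x x
  lift x to F using hx
  rw [absMulHeight₁_coe]
  exact Real.one_le_rpow (one_le_mulHeight₁ x) (by positivity)

theorem absLogHeight₁_pow (x : E) (n : ℕ) : absLogHeight₁ (x ^ n) = n * absLogHeight₁ x := by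
  obtain ⟨F, hF, hx, -⟩ := exists_numberField_mem_mem x x
  lift x to F using hx
  rw [← SubmonoidClass.coe_pow, absLogHeight₁_coe, absLogHeight₁_coe, logHeight₁_pow, mul_div_assoc]

theorem absLogHeight₁_neg (x : E) : absLogHeight₁ (-x) = absLogHeight₁ x := by
  obtain ⟨F, hF, hx, -⟩ := exists_numberField_mem_mem x x
  lift x to F using hx
  rw [← NegMemClass.coe_neg, absLogHeight₁_coe, absLogHeight₁_coe, logHeight₁_neg]

theorem absLogHeight₁_add_le (x y : E) :
    absLogHeight₁ (x + y) ≤ Real.log 2 + absLogHeight₁ x + absLogHeight₁ y := by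
  obtain ⟨F, hF, hx, hy⟩ := exists_numberField_mem_mem x y
  lift x to F using hx
  lift y to F using hy
  have hdeg : (0 : ℝ) < finrank ℚ F := Nat.cast_pos.mpr finrank_pos
  have hadd : logHeight₁ (x + y) ≤ finrank ℚ F * Real.log 2 + logHeight₁ x + logHeight₁ y := by
    simpa only [totalWeight_eq_finrank] using logHeight₁_add_le x y
  rw [← AddMemClass.coe_add, absLogHeight₁_coe, absLogHeight₁_coe, absLogHeight₁_coe,
    div_le_iff₀ hdeg, add_mul, add_mul, div_mul_cancel₀ _ hdeg.ne', div_mul_cancel₀ _ hdeg.ne']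
  linarith

theorem abs_absLogHeight₁_add_sub_le (x c : E) :
    |absLogHeight₁ (x + c) - absLogHeight₁ x| ≤ Real.log 2 + absLogHeight₁ c := by
  have hle := absLogHeight₁_add_le x c
  have hge := absLogHeight₁_add_le (x + c) (-c)
  rw [add_neg_cancel_right, absLogHeight₁_neg] at hge
  rw [abs_le]
  constructor <;> linarith

end Absolute

/-! ### Unicritical maps on the projective line -/

section Points

variable {k : Type*} [Field k]

theorem eq_inftyPt_or_exists_eq_affinePt (P : P1 k) : P = inftyPt k ∨ ∃ t, P = affinePt t := by
  induction P using Projectivization.ind with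
  | h v hv =>
    by_cases hv₁ : v 1 = 0
    · left
      rw [inftyPt, Projectivization.mk_eq_mk_iff']
      refine ⟨v 0, ?_⟩
      ext i; fin_cases i <;> simp [hv₁]
    · right
      refine ⟨v 0 / v 1, ?_⟩
      rw [affinePt, Projectivization.mk_eq_mk_iff']
      refine ⟨v 1, ?_⟩
      ext i; fin_cases i <;> simp [hv₁, mul_div_cancel₀]

theorem affinePt_injective : Function.Injective (affinePt : k → P1 k) := by
  intro s t h
  rw [affinePt, affinePt, Projectivization.mk_eq_mk_iff'] at h
  obtain ⟨a, ha⟩ := h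
  have ha₁ : a = 1 := by simpa using congrFun ha 1
  simpa [ha₁] using (congrFun ha 0).symm

theorem unicritical_affinePt (d : ℕ) (c t : k) :
    unicritical d c (affinePt t) = affinePt (t ^ d + c) := by
  change Projectivization.mk k _ _ = Projectivization.mk k _ _
  congr 1
  ext i; fin_cases i <;> simp [unicriticalForms]

theorem unicritical_inftyPt {d : ℕ} (hd : d ≠ 0) (c : k) :
    unicritical d c (inftyPt k) = inftyPt k := by
  change Projectivization.mk k _ _ = Projectivization.mk k _ _
  congr 1
  ext i; fin_cases i <;> simp [unicriticalForms, hd]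

theorem exists_rep_inftyPt_eq : ∃ a : k, (inftyPt k).rep = ![a, 0] := by
  obtain ⟨a, ha⟩ := Projectivization.exists_smul_eq_mk_rep k ![(1 : k), 0] (by simp)
  refine ⟨a, ?_⟩
  rw [inftyPt, ← ha]
  ext i; fin_cases i <;> simp [Units.smul_def]

theorem exists_rep_affinePt_eq (t : k) : ∃ a : k, a ≠ 0 ∧ (affinePt t).rep = ![a * t, a] := by
  obtain ⟨a, ha⟩ := Projectivization.exists_smul_eq_mk_rep k ![t, 1] (by simp)
  refine ⟨a, a.ne_zero, ?_⟩
  rw [affinePt, ← ha]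
  ext i; fin_cases i <;> simp [Units.smul_def]

theorem isPullback_unicritical (d : ℕ) (c : k) :
    IsPullback (unicritical d c) (hyperplaneClass k) ((d : ℝ) • hyperplaneClass k) := by
  refine ⟨unicriticalForms d c, rfl, Finsupp.single (inftyPt k) 1, rfl, ?_⟩
  obtain ⟨a, ha⟩ := exists_rep_inftyPt_eq (k := k)
  have hform : MvPolynomial.aeval ![(Polynomial.X : Polynomial k), 1]
      (MvPolynomial.C ((inftyPt k).rep 1) * (unicriticalForms d c).form 0 -
        MvPolynomial.C ((inftyPt k).rep 0) * (unicriticalForms d c).form 1) =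
      Polynomial.C (-a) := by
    simp [ha, unicriticalForms, Polynomial.algebraMap_eq]
  have hfiber : (unicriticalForms d c).fiber (inftyPt k) =
      (d : ℝ) • Finsupp.single (inftyPt k) (1 : ℝ) := by
    rw [FormPair.fiber, formDiv, hform, zerosDiv, Polynomial.roots_C, Polynomial.natDegree_C]
    simp [unicriticalForms]
  rw [FormPair.pullback, Finsupp.sum_single_index (by simp), one_smul, hfiber]
  exact map_smul _ _ _

end Points

section HeightP1

instance isAlgebraic_qbar : Algebra.IsAlgebraic ℚ Qbar := by
  -- The two `ℚ`-algebra structures, of `AlgebraicClosure ℚ` and of a division ring, agree.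
  convert! AlgebraicClosure.isAlgebraic ℚ

theorem mulHeight_inftyPt : mulHeight (inftyPt Qbar) = 1 := by
  obtain ⟨a, ha⟩ := exists_rep_inftyPt_eq (k := Qbar)
  simp [mulHeight, ha]

theorem mulHeight_affinePt (t : Qbar) : mulHeight (affinePt t) = NumberField.absMulHeight₁ t := by
  obtain ⟨a, ha₀, ha⟩ := exists_rep_affinePt_eq t
  simp [mulHeight, ha, ha₀]

theorem logHeight_inftyPt : logHeight (inftyPt Qbar) = 0 := by
  rw [logHeight, mulHeight_inftyPt, Real.log_one]

theorem logHeight_affinePt (t : Qbar) : logHeight (affinePt t) = NumberField.absLogHeight₁ t := by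
  rw [logHeight, mulHeight_affinePt, NumberField.absLogHeight₁]

theorem one_le_mulHeight (P : P1 Qbar) : 1 ≤ mulHeight P := by
  obtain rfl | ⟨t, rfl⟩ := eq_inftyPt_or_exists_eq_affinePt P
  · rw [mulHeight_inftyPt]
  · rw [mulHeight_affinePt]
    exact one_le_absMulHeight₁ t

theorem abs_logHeight_unicritical_sub_le {d : ℕ} (hd : d ≠ 0) (c : Qbar) (P : P1 Qbar) :
    |logHeight (unicritical d c P) - d * logHeight P| ≤
      Real.log 2 + NumberField.absLogHeight₁ c := by
  obtain rfl | ⟨t, rfl⟩ := eq_inftyPt_or_exists_eq_affinePt P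
  · have hc : 0 ≤ NumberField.absLogHeight₁ c := Real.log_nonneg (one_le_absMulHeight₁ c)
    rw [unicritical_inftyPt hd, logHeight_inftyPt, mul_zero, sub_zero, abs_zero]
    positivity
  · rw [unicritical_affinePt, logHeight_affinePt, logHeight_affinePt, ← absLogHeight₁_pow]
    exact abs_absLogHeight₁_add_sub_le _ _

end HeightP1

/-! ### Freeness -/

section Freeness

open Polynomial UniqueFactorizationMonoid EuclideanDomain

variable {k : Type*} [Field k]

theorem two_mul_natDegree_radical_le_of_pow_eq_pow [DecidableEq k] {g h : k[X]} {a b : ℕ}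
    (ha : a ≠ 0) (hab : a < b) (hg : g ≠ 0) (hgh : g ^ a = h ^ b) :
    2 * (radical g).natDegree ≤ g.natDegree := by
  obtain ⟨q, rfl⟩ : h ∣ g :=
    (pow_dvd_pow_iff_dvd ha).mp (hgh ▸ pow_dvd_pow h hab.le)
  have hh : h ≠ 0 := left_ne_zero_of_mul hg
  have hqh : q ^ a = h ^ (b - a) := by
    rw [mul_pow, ← Nat.add_sub_cancel' hab.le, pow_add] at hgh
    exact mul_left_cancel₀ (pow_ne_zero a hh) hgh
  have hrad_h : radical (h * q) = radical h := by
    rw [← radical_pow _ ha, hgh, radical_pow _ (by omega)]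
  have hrad_q : radical q = radical h := by
    rw [← radical_pow q ha, hqh, radical_pow h (by omega)]
  have hle_h : (radical h).natDegree ≤ h.natDegree := natDegree_radical_le
  have hle_q : (radical h).natDegree ≤ q.natDegree := hrad_q ▸ natDegree_radical_le
  rw [hrad_h, natDegree_mul hh (right_ne_zero_of_mul hg)]
  omega

/-- The multiple factors of `u ^ e + c` divide its derivative `e * u ^ (e - 1) * u'` and are coprime
to `u`, so they divide `u'`. -/
theorem natDegree_pow_add_C_lt_two_mul_radical [DecidableEq k] [CharZero k] {u : k[X]} {e : ℕ}
    {c : k} (hu : 0 < u.natDegree) (he : 2 ≤ e) (hc : c ≠ 0) :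
    (u ^ e + C c).natDegree < 2 * (radical (u ^ e + C c)).natDegree := by
  set g := u ^ e + C c with hg
  have hdeg : g.natDegree = e * u.natDegree := by rw [hg, natDegree_add_C, natDegree_pow]
  have hg0 : g ≠ 0 := ne_zero_of_natDegree_gt (n := 0) (by rw [hdeg]; positivity)
  have hcop : IsCoprime (divRadical g) (u ^ (e - 1)) := by
    have hgu : IsCoprime g u := by
      refine ⟨C c⁻¹, -C c⁻¹ * u ^ (e - 1), ?_⟩
      rw [hg, mul_assoc, pow_sub_one_mul (by omega), mul_add, ← C_mul, inv_mul_cancel₀ hc, C_1]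
      ring
    exact (hgu.of_isCoprime_of_dvd_left (divRadical_dvd_self g)).pow_right
  have hdvd : divRadical g ∣ derivative u := by
    have he_unit : IsUnit (C (e : k)) := isUnit_C.mpr (Nat.cast_ne_zero.mpr (by omega)).isUnit
    have hderiv : derivative g = C (e : k) * u ^ (e - 1) * derivative u := by
      rw [hg, derivative_add, derivative_C, add_zero, derivative_pow]
    exact ((isCoprime_mul_unit_left_right he_unit _ _).mpr hcop).dvd_of_dvd_mul_left
      (hderiv ▸ divRadical_dvd_derivative g)
  have hlt : (divRadical g).natDegree < u.natDegree :=
    (natDegree_le_of_dvd hdvd (derivative_eq_zero.not.mpr hu.ne')).trans_lt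
      (natDegree_derivative_lt hu.ne')
  have hsum : (radical g).natDegree + (divRadical g).natDegree = g.natDegree := by
    rw [← natDegree_mul radical_ne_zero (divRadical_ne_zero hg0), radical_mul_divRadical]
  nlinarith

variable {ι : Type*} (c : k) (e : ι → ℕ)

/-- The polynomial by which the composition of the maps `z ^ e i + c`, over the letters `i` of a
word, acts on the affine line; the last letter acts first. -/
noncomputable def wordPoly (w : FreeMonoid ι) : k[X] :=
  w.toList.foldr (fun i p => p ^ e i + C c) X

theorem wordPoly_one : wordPoly c e 1 = X := rfl

theorem wordPoly_of_mul (i : ι) (w : FreeMonoid ι) :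
    wordPoly c e (FreeMonoid.of i * w) = wordPoly c e w ^ e i + C c := rfl

variable {c e}

theorem natDegree_wordPoly_pos (he : ∀ i, 2 ≤ e i) (w : FreeMonoid ι) :
    0 < (wordPoly c e w).natDegree := by
  induction w using FreeMonoid.inductionOn' with
  | one => rw [wordPoly_one, natDegree_X]; exact one_pos
  | of_mul i w ih =>
    rw [wordPoly_of_mul, natDegree_add_C, natDegree_pow]
    exact Nat.mul_pos (by linarith [he i]) ih

theorem monic_wordPoly (he : ∀ i, 2 ≤ e i) (w : FreeMonoid ι) : (wordPoly c e w).Monic := by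
  induction w using FreeMonoid.inductionOn' with
  | one => exact monic_X
  | of_mul i w ih =>
    refine (ih.pow (e i)).add_of_left (degree_C_le.trans_lt ?_)
    rw [← natDegree_pos_iff_degree_pos, natDegree_pow]
    exact Nat.mul_pos (by linarith [he i]) (natDegree_wordPoly_pos he w)

theorem natDegree_wordPoly_lt_two_mul_radical [DecidableEq k] [CharZero k] (hc : c ≠ 0)
    (he : ∀ i, 2 ≤ e i) (w : FreeMonoid ι) :
    (wordPoly c e w).natDegree < 2 * (radical (wordPoly c e w)).natDegree := by
  induction w using FreeMonoid.inductionOn' with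
  | one => simp [wordPoly_one, radical_of_prime prime_X, monic_X.normalize_eq_self]
  | of_mul i w _ =>
    exact natDegree_pow_add_C_lt_two_mul_radical (natDegree_wordPoly_pos he w) (he i) hc

theorem eq_and_eq_of_wordPoly_pow_eq [CharZero k] (hc : c ≠ 0) (he : ∀ i, 2 ≤ e i)
    {v w : FreeMonoid ι} {a b : ℕ} (ha : a ≠ 0) (hb : b ≠ 0)
    (h : wordPoly c e v ^ a = wordPoly c e w ^ b) : a = b ∧ wordPoly c e v = wordPoly c e w := by
  classical
  have not_exp_lt {v w : FreeMonoid ι} {a b : ℕ} (ha : a ≠ 0)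
      (h : wordPoly c e v ^ a = wordPoly c e w ^ b) : ¬ a < b := fun hab =>
    (natDegree_wordPoly_lt_two_mul_radical hc he v).not_ge <|
      two_mul_natDegree_radical_le_of_pow_eq_pow ha hab (monic_wordPoly he v).ne_zero h
  obtain rfl : a = b := le_antisymm (not_lt.mp (not_exp_lt hb h.symm)) (not_lt.mp (not_exp_lt ha h))
  refine ⟨rfl, eq_of_monic_of_associated (monic_wordPoly he v) (monic_wordPoly he w) ?_⟩
  exact associated_of_dvd_dvd ((pow_dvd_pow_iff_dvd ha).mp h.dvd)
    ((pow_dvd_pow_iff_dvd ha).mp h.symm.dvd)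

theorem wordPoly_injective [CharZero k] (hc : c ≠ 0) (he : ∀ i, 2 ≤ e i)
    (he_inj : Function.Injective e) : Function.Injective (wordPoly c e) := by
  have ne_X (i : ι) (w : FreeMonoid ι) : wordPoly c e (FreeMonoid.of i * w) ≠ X := fun h => by
    have hdeg := congrArg natDegree h
    rw [wordPoly_of_mul, natDegree_add_C, natDegree_pow, natDegree_X] at hdeg
    linarith [he i, Nat.eq_one_of_mul_eq_one_right hdeg]
  intro v
  induction v using FreeMonoid.inductionOn' with
  | one =>
    intro w h
    cases w using FreeMonoid.casesOn with
    | one => rfl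
    | of_mul j w => exact absurd h.symm (ne_X j w)
  | of_mul i v ih =>
    intro w h
    cases w using FreeMonoid.casesOn with
    | one => exact absurd h (ne_X i v)
    | of_mul j w =>
      obtain ⟨hij, hvw⟩ := eq_and_eq_of_wordPoly_pow_eq hc he (by linarith [he i])
        (by linarith [he j]) (add_right_cancel h)
      rw [he_inj hij, ih hvw]

theorem lift_unicritical_affinePt (w : FreeMonoid ι) (t : k) :
    FreeMonoid.lift (fun i => unicritical (e i) c) w (affinePt t) =
      affinePt ((wordPoly c e w).eval t) := by
  induction w using FreeMonoid.inductionOn' with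
  | one => rw [map_one, wordPoly_one, eval_X]; rfl
  | of_mul i w ih =>
    rw [map_mul, FreeMonoid.lift_eval_of, wordPoly_of_mul, eval_add, eval_pow, eval_C,
      ← unicritical_affinePt, ← ih]
    rfl

theorem lift_unicritical_injective [CharZero k] (hc : c ≠ 0) (he : ∀ i, 2 ≤ e i)
    (he_inj : Function.Injective e) :
    Function.Injective (FreeMonoid.lift fun i => unicritical (e i) c) := by
  intro v w h
  refine wordPoly_injective hc he he_inj (Polynomial.funext fun t => affinePt_injective ?_)
  rw [← lift_unicritical_affinePt, h, lift_unicritical_affinePt]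

end Freeness

/-! ### Counting words by weighted length -/

section SeparatedSums

variable {ι : Type*} {ℓ : ι → ℝ} {δ s : ℝ}

/-- The values `⌊ℓ i / δ⌋₊` are pairwise distinct, so the sum is dominated by a geometric series. -/
theorem summable_exp_and_tsum_le_of_separated (hδ : 0 < δ) (hs : 0 < s) (hℓ : ∀ i, 0 ≤ ℓ i)
    (hsep : Pairwise fun i j => δ < |ℓ i - ℓ j|) :
    Summable (fun i => Real.exp (-(s * ℓ i))) ∧
      ∑' i, Real.exp (-(s * ℓ i)) ≤ (1 - Real.exp (-(s * δ)))⁻¹ := by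
  set r := Real.exp (-(s * δ))
  have hr₀ : 0 ≤ r := Real.exp_nonneg _
  have hr₁ : r < 1 := Real.exp_lt_one_iff.mpr (neg_lt_zero.mpr (mul_pos hs hδ))
  have hinj : Function.Injective fun i => ⌊ℓ i / δ⌋₊ := by
    intro i j hij
    by_contra hne
    have hlt : |ℓ i / δ - ℓ j / δ| < 1 := by
      have hfloor : (⌊ℓ i / δ⌋₊ : ℝ) = ⌊ℓ j / δ⌋₊ := congrArg Nat.cast hij
      rw [abs_lt]
      constructor <;>
        linarith [Nat.floor_le (div_nonneg (hℓ i) hδ.le), Nat.lt_floor_add_one (ℓ i / δ),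
          Nat.floor_le (div_nonneg (hℓ j) hδ.le), Nat.lt_floor_add_one (ℓ j / δ)]
    rw [← sub_div, abs_div, abs_of_pos hδ, div_lt_one hδ] at hlt
    exact hlt.not_gt (hsep hne)
  have hle (i : ι) : Real.exp (-(s * ℓ i)) ≤ r ^ ⌊ℓ i / δ⌋₊ := by
    rw [← Real.exp_nat_mul, Real.exp_le_exp]
    have hfloor := (le_div_iff₀ hδ).mp (Nat.floor_le (div_nonneg (hℓ i) hδ.le))
    nlinarith
  have hgeom : Summable fun n : ℕ => r ^ n := summable_geometric_of_lt_one hr₀ hr₁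
  have hsum : Summable fun i => Real.exp (-(s * ℓ i)) :=
    .of_nonneg_of_le (fun i => Real.exp_nonneg _) hle (hgeom.comp_injective hinj)
  refine ⟨hsum, (hsum.tsum_le_tsum hle (hgeom.comp_injective hinj)).trans ?_⟩
  rw [← tsum_geometric_of_lt_one hr₀ hr₁]
  exact tsum_comp_le_tsum_of_inj hgeom (fun n => pow_nonneg hr₀ n) hinj

theorem one_sub_sum_exp_le_of_separated (hδ : 0 < δ) (hs : 0 < s)
    (hsep : Pairwise fun i j => δ < |ℓ i - ℓ j|) (hsum : HasSum (fun i => Real.exp (-(s * ℓ i))) 1)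
    {t : ℝ} {L : Finset ι} (hL : ∀ i, ℓ i ≤ t → i ∈ L) :
    1 - ∑ i ∈ L, Real.exp (-(s * ℓ i)) ≤
      (1 - Real.exp (-(s * δ)))⁻¹ * Real.exp (-(s * t)) := by
  have htail := hsum.summable.sum_add_tsum_subtype_compl L
  have hshift (i : ι) : Real.exp (-(s * ℓ i)) =
      Real.exp (-(s * (ℓ i - t))) * Real.exp (-(s * t)) := by
    rw [← Real.exp_add]; ring_nf
  have hbound := (summable_exp_and_tsum_le_of_separated (ℓ := fun i : {i // i ∉ L} => ℓ i - t) hδ hs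
    (fun i => sub_nonneg.mpr (not_le.mp (mt (hL i) i.2)).le)
    (fun i j hij => by simpa using hsep (Subtype.coe_ne_coe.mpr hij))).2
  rw [hsum.tsum_eq] at htail
  calc 1 - ∑ i ∈ L, Real.exp (-(s * ℓ i))
      = ∑' i : {i // i ∉ L}, Real.exp (-(s * ℓ i)) := by linarith
    _ = (∑' i : {i // i ∉ L}, Real.exp (-(s * (ℓ i - t)))) * Real.exp (-(s * t)) := by
        rw [← tsum_mul_right]
        exact tsum_congr fun i => hshift i
    _ ≤ _ := mul_le_mul_of_nonneg_right hbound (Real.exp_nonneg _)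

end SeparatedSums

section CriticalExponent

open Filter Topology

variable {ι : Type*} {ℓ : ι → ℝ}

theorem tendsto_cofinite_atTop_of_summable_exp {s : ℝ} (hs : 0 < s)
    (hsum : Summable fun i => Real.exp (-(s * ℓ i))) : Tendsto ℓ cofinite atTop := by
  have h := Real.tendsto_exp_comp_nhds_zero.mp hsum.tendsto_cofinite_zero
  rwa [tendsto_neg_atBot_iff, tendsto_const_mul_atTop_of_pos hs] at h

theorem exists_finset_mem_iff_le (hlim : Tendsto ℓ cofinite atTop) (t : ℝ) :
    ∃ L : Finset ι, ∀ i, i ∈ L ↔ ℓ i ≤ t := by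
  have hfin : {i | ℓ i ≤ t}.Finite := by
    simpa using eventually_cofinite.mp (hlim.eventually_gt_atTop t)
  exact ⟨hfin.toFinset, fun i => hfin.mem_toFinset⟩

theorem exists_pos_one_lt_tsum_exp [Nontrivial ι]
    (hsum : ∀ s, 0 < s → Summable fun i => Real.exp (-(s * ℓ i))) :
    ∃ s, 0 < s ∧ 1 < ∑' i, Real.exp (-(s * ℓ i)) := by
  classical
  obtain ⟨i, j, hij⟩ := exists_pair_ne ι
  have hcont : Tendsto (fun s => Real.exp (-(s * ℓ i)) + Real.exp (-(s * ℓ j))) (𝓝[>] 0) (𝓝 2) := by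
    refine Tendsto.mono_left ?_ nhdsWithin_le_nhds
    refine Continuous.tendsto' (by fun_prop) _ _ ?_
    norm_num
  obtain ⟨s, h₁, hs⟩ :=
    ((hcont.eventually_const_lt one_lt_two).and self_mem_nhdsWithin).exists
  refine ⟨s, hs, h₁.trans_le ?_⟩
  rw [← Finset.sum_pair (f := fun i => Real.exp (-(s * ℓ i))) hij]
  exact (hsum s hs).sum_le_tsum {i, j} fun _ _ => Real.exp_nonneg _

theorem tendsto_tsum_exp_atTop (hℓ : ∀ i, 0 < ℓ i)
    (hsum : Summable fun i => Real.exp (-(1 * ℓ i))) :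
    Tendsto (fun s => ∑' i, Real.exp (-(s * ℓ i))) atTop (𝓝 0) := by
  have hterm (i : ι) : Tendsto (fun s => Real.exp (-(s * ℓ i))) atTop (𝓝 0) :=
    Real.tendsto_exp_neg_atTop_nhds_zero.comp (tendsto_id.atTop_mul_const (hℓ i))
  rw [← tsum_zero (α := ℝ) (β := ι)]
  refine tendsto_tsum_of_dominated_convergence hsum hterm ?_
  filter_upwards [eventually_ge_atTop 1] with s hs i
  rw [Real.norm_of_nonneg (Real.exp_nonneg _), Real.exp_le_exp]
  exact neg_le_neg (mul_le_mul_of_nonneg_right hs (hℓ i).le)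

theorem exists_pos_hasSum_exp_one [Nontrivial ι] (hℓ : ∀ i, 0 < ℓ i)
    (hsum : ∀ s, 0 < s → Summable fun i => Real.exp (-(s * ℓ i))) :
    ∃ b, 0 < b ∧ HasSum (fun i => Real.exp (-(b * ℓ i))) 1 := by
  obtain ⟨s₁, hs₁, hgt⟩ := exists_pos_one_lt_tsum_exp hsum
  obtain ⟨s₂, hlt, hs₁₂⟩ :=
    (((tendsto_tsum_exp_atTop hℓ (hsum 1 one_pos)).eventually_lt_const one_pos).and
      (eventually_ge_atTop s₁)).exists
  have hcont : ContinuousOn (fun s => ∑' i, Real.exp (-(s * ℓ i))) (Set.Icc s₁ s₂) := by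
    refine continuousOn_tsum (fun i => by fun_prop) (hsum s₁ hs₁) fun i s hs => ?_
    rw [Real.norm_of_nonneg (Real.exp_nonneg _), Real.exp_le_exp]
    exact neg_le_neg (mul_le_mul_of_nonneg_right hs.1 (hℓ i).le)
  obtain ⟨b, hb, hb₁⟩ := intermediate_value_Icc' hs₁₂ hcont ⟨hlt.le, hgt.le⟩
  have hb₀ : 0 < b := hs₁.trans_le hb.1
  exact ⟨b, hb₀, hb₁ ▸ (hsum b hb₀).hasSum⟩

end CriticalExponent

section WordCount

open Filter

variable {ι : Type*} {ℓ : ι → ℝ} {b : ℝ}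

/-- The weighted length of a word: the sum of the weights `ℓ i` of its letters. -/
def wordLength (ℓ : ι → ℝ) (w : FreeMonoid ι) : ℝ := (w.toList.map ℓ).sum

theorem wordLength_one : wordLength ℓ 1 = 0 := rfl

theorem wordLength_of_mul (i : ι) (w : FreeMonoid ι) :
    wordLength ℓ (FreeMonoid.of i * w) = ℓ i + wordLength ℓ w := rfl

theorem wordLength_nonneg (hℓ : ∀ i, 0 < ℓ i) (w : FreeMonoid ι) : 0 ≤ wordLength ℓ w := by
  induction w using FreeMonoid.inductionOn' with
  | one => exact wordLength_one.ge
  | of_mul i w ih => rw [wordLength_of_mul]; linarith [hℓ i]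

/-- The words of weighted length at most `t`, whose number is to be estimated as `t → ∞`. -/
def wordsLE (ℓ : ι → ℝ) (t : ℝ) : Set (FreeMonoid ι) := {w | wordLength ℓ w ≤ t}

theorem wordsLE_mono {t t' : ℝ} (h : t ≤ t') : wordsLE ℓ t ⊆ wordsLE ℓ t' :=
  fun _ hw => le_trans hw h

theorem wordsLE_eq_insert (hℓ : ∀ i, 0 < ℓ i) {t : ℝ} (ht : 0 ≤ t) {L : Finset ι}
    (hL : ∀ i, i ∈ L ↔ ℓ i ≤ t) :
    wordsLE ℓ t =
      insert 1 (⋃ i ∈ (L : Set ι), (FreeMonoid.of i * ·) '' wordsLE ℓ (t - ℓ i)) := by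
  ext w
  simp only [Set.mem_insert_iff, Set.mem_iUnion, Set.mem_image, exists_prop, wordsLE,
    Set.mem_ofPred_eq, Finset.mem_coe, hL]
  cases w using FreeMonoid.casesOn with
  | one => simpa [wordLength_one] using ht
  | of_mul i w =>
    rw [wordLength_of_mul]
    constructor
    · intro hw
      exact .inr ⟨i, by linarith [wordLength_nonneg hℓ w], w, by linarith, rfl⟩
    · rintro (h | ⟨j, -, v, hv, h⟩)
      · simp at h
      · obtain ⟨rfl, hvw⟩ := List.cons_eq_cons.mp h
        obtain rfl : v = w := hvw
        linarith

/-- Induction in the variable `t ≥ 0` by subtracting letter weights, well-founded because these are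
bounded below by a positive constant. -/
theorem nonneg_induction_sub_weight (hℓ : ∀ i, 0 < ℓ i) (hlim : Tendsto ℓ cofinite atTop)
    {P : ℝ → Prop} (step : ∀ t, 0 ≤ t → (∀ i, ℓ i ≤ t → P (t - ℓ i)) → P t) {t : ℝ} (ht : 0 ≤ t) :
    P t := by
  cases isEmpty_or_nonempty ι with
  | inl _ => exact step t ht isEmptyElim
  | inr _ =>
    obtain ⟨i₀, hmin⟩ := hlim.exists_forall_le
    induction hn : ⌊t / ℓ i₀⌋₊ using Nat.strong_induction_on generalizing t with
    | _ n ih =>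
      refine step t ht fun i hi => ih _ ?_ (sub_nonneg.mpr hi) rfl
      have hfloor : 0 < ⌊t / ℓ i₀⌋₊ :=
        Nat.floor_pos.mpr ((one_le_div (hℓ i₀)).mpr ((hmin i).trans hi))
      calc ⌊(t - ℓ i) / ℓ i₀⌋₊ ≤ ⌊t / ℓ i₀ - 1⌋₊ := by
            rw [sub_div]
            exact Nat.floor_mono (sub_le_sub_left ((one_le_div (hℓ i₀)).mpr (hmin i)) _)
        _ = ⌊t / ℓ i₀⌋₊ - 1 := Nat.floor_sub_one _
        _ < n := by omega

theorem finite_wordsLE (hℓ : ∀ i, 0 < ℓ i) (hlim : Tendsto ℓ cofinite atTop) (t : ℝ) :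
    (wordsLE ℓ t).Finite := by
  refine Set.Finite.subset ?_ (wordsLE_mono (le_max_left t 0))
  refine nonneg_induction_sub_weight (P := fun t => (wordsLE ℓ t).Finite) hℓ hlim
    (fun t ht ih => ?_) (le_max_right t 0)
  obtain ⟨L, hL⟩ := exists_finset_mem_iff_le hlim t
  rw [wordsLE_eq_insert hℓ ht hL]
  exact (L.finite_toSet.biUnion fun i hi => (ih i ((hL i).mp hi)).image _).insert 1

theorem ncard_wordsLE_eq (hℓ : ∀ i, 0 < ℓ i) (hlim : Tendsto ℓ cofinite atTop) {t : ℝ}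
    (ht : 0 ≤ t) {L : Finset ι} (hL : ∀ i, i ∈ L ↔ ℓ i ≤ t) :
    (wordsLE ℓ t).ncard = 1 + ∑ i ∈ L, (wordsLE ℓ (t - ℓ i)).ncard := by
  have hfin (i : ι) : ((FreeMonoid.of i * ·) '' wordsLE ℓ (t - ℓ i)).Finite :=
    (finite_wordsLE hℓ hlim _).image _
  have hdisj : (L : Set ι).PairwiseDisjoint
      fun i => (FreeMonoid.of i * ·) '' wordsLE ℓ (t - ℓ i) := by
    intro i _ j _ hij
    refine Set.disjoint_left.mpr ?_
    rintro _ ⟨v, -, rfl⟩ ⟨w, -, h⟩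
    exact hij (List.cons_eq_cons.mp h).1.symm
  rw [wordsLE_eq_insert hℓ ht hL,
    Set.ncard_insert_of_notMem (by simp) (L.finite_toSet.biUnion fun i _ => hfin i),
    L.finite_toSet.ncard_biUnion (fun i _ => hfin i) hdisj, finsum_mem_coe_finset, add_comm]
  exact congrArg _ (Finset.sum_congr rfl fun i _ =>
    Set.ncard_image_of_injective _ (mul_right_injective _))

theorem exists_ncard_wordsLE_le [Nontrivial ι] (hℓ : ∀ i, 0 < ℓ i) (hb : 0 < b)
    (hsum : HasSum (fun i => Real.exp (-(b * ℓ i))) 1) :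
    ∃ C, 0 < C ∧ ∀ t, 0 ≤ t → ((wordsLE ℓ t).ncard : ℝ) ≤ C * Real.exp (b * t) := by
  classical
  have hlim := tendsto_cofinite_atTop_of_summable_exp hb hsum.summable
  obtain ⟨i, j, hij⟩ := exists_pair_ne ι
  set t₀ := max (ℓ i) (ℓ j)
  set C : ℝ := (wordsLE ℓ t₀).ncard + 1
  have hC : 0 < C := by positivity
  refine ⟨C, hC, fun t ht => le_of_add_le_of_nonneg_left ?_ zero_le_one⟩
  refine nonneg_induction_sub_weight
    (P := fun t => ((wordsLE ℓ t).ncard : ℝ) + 1 ≤ C * Real.exp (b * t)) hℓ hlim ?_ ht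
  intro t ht ih
  obtain h | h := le_total t t₀
  · have hmono : (wordsLE ℓ t).ncard ≤ (wordsLE ℓ t₀).ncard :=
      Set.ncard_le_ncard (wordsLE_mono h) (finite_wordsLE hℓ hlim t₀)
    calc ((wordsLE ℓ t).ncard : ℝ) + 1 ≤ C := add_le_add_left (Nat.cast_le.mpr hmono) 1
      _ ≤ C * Real.exp (b * t) := le_mul_of_one_le_right hC.le (Real.one_le_exp (by positivity))
  · obtain ⟨L, hL⟩ := exists_finset_mem_iff_le hlim t
    have hcard : (2 : ℝ) ≤ L.card := by
      have hpair : {i, j} ⊆ L := by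
        simp [Finset.insert_subset_iff, hL, (le_max_left _ _).trans h, (le_max_right _ _).trans h]
      exact_mod_cast (Finset.card_pair hij).symm.le.trans (Finset.card_le_card hpair)
    calc ((wordsLE ℓ t).ncard : ℝ) + 1
        = 2 + ∑ i ∈ L, ((wordsLE ℓ (t - ℓ i)).ncard : ℝ) := by
          rw [ncard_wordsLE_eq hℓ hlim ht hL]; push_cast; ring
      _ ≤ ∑ i ∈ L, (((wordsLE ℓ (t - ℓ i)).ncard : ℝ) + 1) := by
          rw [Finset.sum_add_distrib, Finset.sum_const, nsmul_eq_mul, mul_one]; linarith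
      _ ≤ ∑ i ∈ L, C * Real.exp (b * (t - ℓ i)) :=
          Finset.sum_le_sum fun i hi => ih i ((hL i).mp hi)
      _ = C * Real.exp (b * t) * ∑ i ∈ L, Real.exp (-(b * ℓ i)) := by
          simp_rw [Finset.mul_sum, mul_assoc, ← Real.exp_add]; ring_nf
      _ ≤ C * Real.exp (b * t) :=
          mul_le_of_le_one_right (by positivity)
            (sum_le_hasSum L (fun _ _ => Real.exp_nonneg _) hsum)

theorem le_ncard_wordsLE {δ : ℝ} (hδ : 0 < δ) (hℓ : ∀ i, 0 < ℓ i)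
    (hsep : Pairwise fun i j => δ < |ℓ i - ℓ j|) (hb : 0 < b)
    (hsum : HasSum (fun i => Real.exp (-(b * ℓ i))) 1) {t : ℝ} (ht : 0 ≤ t) :
    (1 - Real.exp (-(b * δ))) * Real.exp (b * t) ≤ (wordsLE ℓ t).ncard := by
  have hlim := tendsto_cofinite_atTop_of_summable_exp hb hsum.summable
  set c := 1 - Real.exp (-(b * δ))
  have hc : 0 < c :=
    sub_pos.mpr (Real.exp_lt_one_iff.mpr (neg_lt_zero.mpr (mul_pos hb hδ)))
  refine nonneg_induction_sub_weight
    (P := fun t => c * Real.exp (b * t) ≤ (wordsLE ℓ t).ncard) hℓ hlim ?_ ht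
  intro t ht ih
  obtain ⟨L, hL⟩ := exists_finset_mem_iff_le hlim t
  have hloss : c * Real.exp (b * t) * (1 - ∑ i ∈ L, Real.exp (-(b * ℓ i))) ≤ 1 := by
    refine (mul_le_mul_of_nonneg_left (one_sub_sum_exp_le_of_separated hδ hb hsep hsum
      fun i => (hL i).mpr) (by positivity)).trans_eq ?_
    rw [mul_mul_mul_comm, mul_inv_cancel₀ hc.ne', ← Real.exp_add, add_neg_cancel, Real.exp_zero,
      one_mul]
  calc c * Real.exp (b * t)
      ≤ 1 + c * Real.exp (b * t) * ∑ i ∈ L, Real.exp (-(b * ℓ i)) := by linarith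
    _ = 1 + ∑ i ∈ L, c * Real.exp (b * (t - ℓ i)) := by
        simp_rw [Finset.mul_sum, mul_assoc, ← Real.exp_add]; ring_nf
    _ ≤ 1 + ∑ i ∈ L, ((wordsLE ℓ (t - ℓ i)).ncard : ℝ) :=
        add_le_add_right (Finset.sum_le_sum fun i hi => ih i ((hL i).mp hi)) 1
    _ = (wordsLE ℓ t).ncard := by rw [ncard_wordsLE_eq hℓ hlim ht hL]; push_cast; rfl

end WordCount

/-! ### Orbit counting -/

section OrbitGrowth

open Filter

variable {ι X : Type*} {ℓ : ι → ℝ} {φ : ι → Function.End X} {h : X → ℝ} {A : ℝ}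

theorem exists_forall_le_mul_exp_sub_one [Nonempty ι] (hℓ : ∀ i, 0 < ℓ i)
    (hlim : Tendsto ℓ cofinite atTop) (C : ℝ) :
    ∃ A, 0 ≤ A ∧ ∀ i, C ≤ A * (Real.exp (ℓ i) - 1) := by
  obtain ⟨i₀, hmin⟩ := hlim.exists_forall_le
  have hpos : 0 < Real.exp (ℓ i₀) - 1 := sub_pos.mpr (Real.one_lt_exp_iff.mpr (hℓ i₀))
  refine ⟨|C| / (Real.exp (ℓ i₀) - 1), by positivity, fun i => ?_⟩
  calc C ≤ |C| / (Real.exp (ℓ i₀) - 1) * (Real.exp (ℓ i₀) - 1) := by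
        rw [div_mul_cancel₀ _ hpos.ne']; exact le_abs_self C
    _ ≤ |C| / (Real.exp (ℓ i₀) - 1) * (Real.exp (ℓ i) - 1) := by gcongr; exact hmin i

/-- The error `A * (d - 1)` for a map of degree `d` is compatible with composition: an error
`A * (d - 1)` scaled by `d'` plus an error `A * (d' - 1)` is `A * (d' * d - 1)`. -/
theorem abs_height_lift_sub_le
    (hφ : ∀ i P, |h (φ i P) - Real.exp (ℓ i) * h P| ≤ A * (Real.exp (ℓ i) - 1))
    (w : FreeMonoid ι) (P : X) :
    |h (FreeMonoid.lift φ w P) - Real.exp (wordLength ℓ w) * h P| ≤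
      A * (Real.exp (wordLength ℓ w) - 1) := by
  induction w using FreeMonoid.inductionOn' with
  | one => simp [wordLength_one, Function.End.one_def]
  | of_mul i w ih =>
    set Q := FreeMonoid.lift φ w P
    set m := Real.exp (wordLength ℓ w)
    have hcomp : FreeMonoid.lift φ (FreeMonoid.of i * w) P = φ i Q := by
      rw [map_mul, FreeMonoid.lift_eval_of]; rfl
    rw [hcomp, wordLength_of_mul, Real.exp_add]
    calc |h (φ i Q) - Real.exp (ℓ i) * m * h P|
        = |(h (φ i Q) - Real.exp (ℓ i) * h Q) + Real.exp (ℓ i) * (h Q - m * h P)| := by ring_nf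
      _ ≤ |h (φ i Q) - Real.exp (ℓ i) * h Q| + Real.exp (ℓ i) * |h Q - m * h P| := by
          rw [← Real.abs_exp (ℓ i), ← abs_mul, Real.abs_exp]
          exact abs_add_le _ _
      _ ≤ A * (Real.exp (ℓ i) - 1) + Real.exp (ℓ i) * (A * (m - 1)) := by
          gcongr
          exact hφ i Q
      _ = A * (Real.exp (ℓ i) * m - 1) := by ring

theorem wordsLE_subset_setOf_height_le (hA : 0 ≤ A)
    (hφ : ∀ i P, |h (φ i P) - Real.exp (ℓ i) * h P| ≤ A * (Real.exp (ℓ i) - 1)) {P : X} {T : ℝ}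
    (hP : 0 < h P + A) (hT : 0 < T) :
    wordsLE ℓ (Real.log (T / (h P + A))) ⊆ {w | h (FreeMonoid.lift φ w P) ≤ T} := by
  intro w hw
  have hlen : Real.exp (wordLength ℓ w) * (h P + A) ≤ T :=
    (le_div_iff₀ hP).mp ((Real.le_log_iff_exp_le (div_pos hT hP)).mp hw)
  have hupper := (abs_le.mp (abs_height_lift_sub_le hφ w P)).2
  change h (FreeMonoid.lift φ w P) ≤ T
  linarith

theorem setOf_height_le_subset_wordsLE (hA : 0 ≤ A)
    (hφ : ∀ i P, |h (φ i P) - Real.exp (ℓ i) * h P| ≤ A * (Real.exp (ℓ i) - 1)) {P : X} {T : ℝ}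
    (hP : A < h P) (hT : 0 < T) :
    {w | h (FreeMonoid.lift φ w P) ≤ T} ⊆ wordsLE ℓ (Real.log (T / (h P - A))) := by
  intro w (hw : h (FreeMonoid.lift φ w P) ≤ T)
  have hlower := (abs_le.mp (abs_height_lift_sub_le hφ w P)).1
  change wordLength ℓ w ≤ _
  rw [Real.le_log_iff_exp_le (div_pos hT (sub_pos.mpr hP)), le_div_iff₀ (sub_pos.mpr hP)]
  linarith

theorem exp_mul_log_div {b T a : ℝ} (hT : 0 < T) (ha : 0 < a) :
    Real.exp (b * Real.log (T / a)) = T ^ b / a ^ b := by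
  rw [mul_comm, ← Real.rpow_def_of_pos (div_pos hT ha), Real.div_rpow hT.le ha.le]

theorem exists_ncard_words_height_le_bounds [Nontrivial ι] {δ C : ℝ} (hδ : 0 < δ)
    (hℓ : ∀ i, 0 < ℓ i) (hsep : Pairwise fun i j => δ < |ℓ i - ℓ j|)
    (hφ : ∀ i P, |h (φ i P) - Real.exp (ℓ i) * h P| ≤ C) :
    ∃ A b : ℝ, 0 < b ∧ ∀ P, A < h P → ∃ c₁ c₂ : ℝ, 0 < c₁ ∧ 0 < c₂ ∧ ∀ᶠ T : ℝ in atTop,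
      {w | h (FreeMonoid.lift φ w P) ≤ T}.Finite ∧
      c₁ * T ^ b ≤ ({w | h (FreeMonoid.lift φ w P) ≤ T}.ncard : ℝ) ∧
      ({w | h (FreeMonoid.lift φ w P) ≤ T}.ncard : ℝ) ≤ c₂ * T ^ b := by
  obtain ⟨b, hb, hsum⟩ := exists_pos_hasSum_exp_one hℓ fun s hs =>
    (summable_exp_and_tsum_le_of_separated hδ hs (fun i => (hℓ i).le) hsep).1
  have hlim := tendsto_cofinite_atTop_of_summable_exp hb hsum.summable
  obtain ⟨A, hA, hCA⟩ := exists_forall_le_mul_exp_sub_one hℓ hlim C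
  obtain ⟨K, hK, hupper⟩ := exists_ncard_wordsLE_le hℓ hb hsum
  have hφA (i : ι) (P : X) := (hφ i P).trans (hCA i)
  have hgap : 0 < 1 - Real.exp (-(b * δ)) :=
    sub_pos.mpr (Real.exp_lt_one_iff.mpr (neg_lt_zero.mpr (mul_pos hb hδ)))
  refine ⟨A, b, hb, fun P hP => ?_⟩
  have hsub : 0 < h P - A := sub_pos.mpr hP
  have hadd : 0 < h P + A := by linarith
  refine ⟨(1 - Real.exp (-(b * δ))) / (h P + A) ^ b, K / (h P - A) ^ b,
    div_pos hgap (Real.rpow_pos_of_pos hadd b), div_pos hK (Real.rpow_pos_of_pos hsub b), ?_⟩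
  filter_upwards [eventually_ge_atTop (h P + A)] with T hT
  have hT₀ : 0 < T := hadd.trans_le hT
  have hfin : {w | h (FreeMonoid.lift φ w P) ≤ T}.Finite :=
    (finite_wordsLE hℓ hlim _).subset (setOf_height_le_subset_wordsLE hA hφA hP hT₀)
  refine ⟨hfin, ?_, ?_⟩
  · calc (1 - Real.exp (-(b * δ))) / (h P + A) ^ b * T ^ b
        = (1 - Real.exp (-(b * δ))) * Real.exp (b * Real.log (T / (h P + A))) := by
          rw [exp_mul_log_div hT₀ hadd, div_mul_eq_mul_div, mul_div_assoc]
      _ ≤ (wordsLE ℓ (Real.log (T / (h P + A)))).ncard :=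
          le_ncard_wordsLE hδ hℓ hsep hb hsum (Real.log_nonneg ((one_le_div hadd).mpr hT))
      _ ≤ _ := Nat.cast_le.mpr
          (Set.ncard_le_ncard (wordsLE_subset_setOf_height_le hA hφA hadd hT₀) hfin)
  · calc _ ≤ ((wordsLE ℓ (Real.log (T / (h P - A)))).ncard : ℝ) := Nat.cast_le.mpr
          (Set.ncard_le_ncard (setOf_height_le_subset_wordsLE hA hφA hP hT₀)
            (finite_wordsLE hℓ hlim _))
      _ ≤ K * Real.exp (b * Real.log (T / (h P - A))) :=
          hupper _ (Real.log_nonneg ((one_le_div hsub).mpr (by linarith)))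
      _ = K / (h P - A) ^ b * T ^ b := by
          rw [exp_mul_log_div hT₀ hsub, div_mul_eq_mul_div, mul_div_assoc]

end OrbitGrowth

section FunctionCount

open Filter

variable {S : Set (Function.End (P1 Qbar))}

/-- The two-sided bound `(log B) ^ b ≪ #{f ∈ M_S : H(f(P)) ≤ B} ≪ (log B) ^ b` as `B → ∞`, for all
`P` of large height: `FunctionCount` with the same exponent on both sides. The exponent and the
height threshold depend only on `S`, the implied constants on `S` and `P`. -/
def SharpFunctionCount (S : Set (Function.End (P1 Qbar))) : Prop :=
  ∃ B₀ b : ℝ, 0 < b ∧ ∀ P : P1 Qbar, B₀ < mulHeight P →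
    ∃ c₁ c₂ : ℝ, 0 < c₁ ∧ 0 < c₂ ∧ ∀ᶠ B : ℝ in atTop,
      {f | f ∈ genMonoid S ∧ mulHeight (f P) ≤ B}.Finite ∧
      c₁ * Real.log B ^ b ≤ ({f | f ∈ genMonoid S ∧ mulHeight (f P) ≤ B}.ncard : ℝ) ∧
      ({f | f ∈ genMonoid S ∧ mulHeight (f P) ≤ B}.ncard : ℝ) ≤ c₂ * Real.log B ^ b

theorem SharpFunctionCount.functionCount (hS : SharpFunctionCount S) : FunctionCount S := by
  obtain ⟨B₀, b, hb, hcount⟩ := hS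
  refine ⟨B₀, fun ε hε => ⟨b, hb, fun P hP => ?_⟩⟩
  obtain ⟨c₁, c₂, hc₁, hc₂, hev⟩ := hcount P hP
  refine ⟨c₁, c₂, hc₁, hc₂, ?_⟩
  filter_upwards [hev, Real.tendsto_log_atTop.eventually_ge_atTop 1] with B ⟨hfin, hlow, hup⟩ hB
  have hpow : Real.log B ^ b ≤ Real.log B ^ (b + ε) :=
    Real.rpow_le_rpow_of_exponent_le hB (by linarith)
  exact ⟨hfin, hlow, hup.trans (mul_le_mul_of_nonneg_left hpow hc₂.le)⟩

theorem setOf_genMonoid_mulHeight_le_eq_image (S : Set (Function.End (P1 Qbar))) (P : P1 Qbar)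
    {B : ℝ} (hB : 0 < B) :
    {f | f ∈ genMonoid S ∧ mulHeight (f P) ≤ B} =
      FreeMonoid.lift (fun φ : S => (φ : Function.End (P1 Qbar))) ''
        {w | logHeight (FreeMonoid.lift (fun φ : S => (φ : Function.End (P1 Qbar))) w P) ≤
          Real.log B} := by
  have hheight (Q : P1 Qbar) : logHeight Q ≤ Real.log B ↔ mulHeight Q ≤ B :=
    Real.log_le_log_iff (one_pos.trans_le (one_le_mulHeight Q)) hB
  ext f
  rw [genMonoid, Submonoid.closure_eq_mrange]
  simp only [hheight]
  constructor
  · rintro ⟨⟨w, rfl⟩, hw⟩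
    exact ⟨w, hw, rfl⟩
  · rintro ⟨w, hw, rfl⟩
    exact ⟨⟨w, rfl⟩, hw⟩

theorem HeightControlledLogDiscrete.sharpFunctionCount (hS : HeightControlledLogDiscrete S)
    (hfree : GeneratesFreely S) (hnontrivial : S.Nontrivial) : SharpFunctionCount S := by
  obtain ⟨d, ⟨hd, C, hC⟩, δ, hδ, hsep⟩ := hS
  have : Nontrivial S := hnontrivial.coe_sort
  obtain ⟨A, b, hb, hcount⟩ := exists_ncard_words_height_le_bounds (h := logHeight)
    (φ := fun φ : S => (φ : Function.End (P1 Qbar))) (ℓ := fun φ : S => Real.log (d φ)) hδ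
    (fun φ => Real.log_pos (hd φ φ.2).1)
    (fun φ ψ hne => hsep φ φ.2 ψ ψ.2 (Subtype.coe_ne_coe.mpr hne))
    (fun φ P => by
      rw [Real.exp_log (one_pos.trans (hd φ φ.2).1)]
      exact hC φ φ.2 P)
  refine ⟨Real.exp A, b, hb, fun P hP => ?_⟩
  obtain ⟨c₁, c₂, hc₁, hc₂, hev⟩ :=
    hcount P ((Real.lt_log_iff_exp_lt ((Real.exp_pos A).trans hP)).mpr hP)
  refine ⟨c₁, c₂, hc₁, hc₂, ?_⟩
  filter_upwards [Real.tendsto_log_atTop.eventually hev, eventually_gt_atTop 0] with B hB hB₀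
  rw [setOf_genMonoid_mulHeight_le_eq_image S P hB₀, Set.ncard_image_of_injective _ hfree]
  exact ⟨hB.1.image _, hB.2⟩

end FunctionCount

section UnicriticalSet

variable {𝔡 : Set ℕ} {c : Qbar}

theorem exists_degree_unicriticalSet (𝔡 : Set ℕ) (c : Qbar) :
    ∃ D : Function.End (P1 Qbar) → ℕ, ∀ φ ∈ unicriticalSet 𝔡 c,
      D φ ∈ 𝔡 ∧ 2 ≤ D φ ∧ φ = unicritical (D φ) c := by
  have h : ∀ φ ∈ unicriticalSet 𝔡 c, ∃ n, n ∈ 𝔡 ∧ 2 ≤ n ∧ φ = unicritical n c := fun _ hφ => hφ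
  choose! D hD using h
  exact ⟨D, hD⟩

theorem heightControlledLogDiscrete_unicriticalSet (h𝔡 : UniformlyLogDiscrete 𝔡) (c : Qbar) :
    HeightControlledLogDiscrete (unicriticalSet 𝔡 c) := by
  obtain ⟨D, hD⟩ := exists_degree_unicriticalSet 𝔡 c
  obtain ⟨δ, hδ, hsep⟩ := h𝔡
  refine ⟨fun φ => D φ, ⟨fun φ hφ => ?_, Real.log 2 + NumberField.absLogHeight₁ c,
    fun φ hφ P => ?_⟩, δ, hδ, fun φ hφ ψ hψ hne => ?_⟩
  · obtain ⟨-, hD₂, hφD⟩ := hD φ hφ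
    refine ⟨Nat.one_lt_cast.mpr hD₂, ?_⟩
    have hpull := isPullback_unicritical (D φ) c
    rwa [← hφD] at hpull
  · obtain ⟨-, hD₂, hφD⟩ := hD φ hφ
    have hbound := abs_logHeight_unicritical_sub_le (d := D φ) (by omega) c P
    rwa [← hφD] at hbound
  · obtain ⟨hφ𝔡, -, hφD⟩ := hD φ hφ
    obtain ⟨hψ𝔡, -, hψD⟩ := hD ψ hψ
    exact hsep _ hφ𝔡 _ hψ𝔡 fun h => hne (by rw [hφD, hψD, h])

theorem generatesFreely_unicriticalSet (𝔡 : Set ℕ) (hc : c ≠ 0) :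
    GeneratesFreely (unicriticalSet 𝔡 c) := by
  obtain ⟨D, hD⟩ := exists_degree_unicriticalSet 𝔡 c
  have heq : (fun φ : unicriticalSet 𝔡 c => (φ : Function.End (P1 Qbar))) =
      fun φ : unicriticalSet 𝔡 c => unicritical (D φ) c := funext fun φ => (hD φ φ.2).2.2
  have hD_inj : Function.Injective fun φ : unicriticalSet 𝔡 c => D φ := fun φ ψ h =>
    Subtype.ext (by rw [(hD φ φ.2).2.2, (hD ψ ψ.2).2.2, show D φ = D ψ from h])
  rw [GeneratesFreely, heq]
  exact lift_unicritical_injective hc (fun φ => (hD φ φ.2).2.1) hD_inj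

end UnicriticalSet

end OrbitCount

theorem corollary3p3_general (𝔡 : Set ℕ) (h𝔡 : OrbitCount.UniformlyLogDiscrete 𝔡)
    (c : OrbitCount.Qbar) (hc : c ≠ 0) :
    OrbitCount.HeightControlledLogDiscrete (OrbitCount.unicriticalSet 𝔡 c) ∧
    OrbitCount.GeneratesFreely (OrbitCount.unicriticalSet 𝔡 c) ∧
    ((OrbitCount.unicriticalSet 𝔡 c).Nontrivial →
      OrbitCount.SharpFunctionCount (OrbitCount.unicriticalSet 𝔡 c)) := by
  have hcontrolled := OrbitCount.heightControlledLogDiscrete_unicriticalSet h𝔡 c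
  have hfree := OrbitCount.generatesFreely_unicriticalSet 𝔡 hc
  exact ⟨hcontrolled, hfree, hcontrolled.sharpFunctionCount hfree⟩

theorem corollary3p3 (𝔡 : Set ℕ) (h𝔡 : OrbitCount.UniformlyLogDiscrete 𝔡)
    (c : OrbitCount.Qbar) (hc : c ≠ 0) :
    OrbitCount.HeightControlledLogDiscrete (OrbitCount.unicriticalSet 𝔡 c) ∧
    OrbitCount.GeneratesFreely (OrbitCount.unicriticalSet 𝔡 c) ∧
    ((OrbitCount.unicriticalSet 𝔡 c).Nontrivial →
      OrbitCount.FunctionCount (OrbitCount.unicriticalSet 𝔡 c)) := by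
  obtain ⟨hcontrolled, hfree, hcount⟩ := corollary3p3_general 𝔡 h𝔡 c hc
  exact ⟨hcontrolled, hfree, fun hS => (hcount hS).functionCount⟩
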